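/- Let $\mathbb{Z}_2[z^{\pm}]$ be the ring of Laurent polynomials over the field with two elements. A \emph{$\delta$-parametric polynomial} is an expression $\mathbf f=\sum_i f_i(z)z^{i\delta}$ ($i\in\mathbb Z$) with finitely many nonzero blocks $f_i\in\mathbb Z_2[z^{\pm}]$; it is nontrivial if some $f_i\neq 0$. For $\delta\in\mathbb Z$, $\mathbf f_\delta\in\mathbb Z_2[z^\pm]$ denotes the Laurent polynomial obtained by substituting the value $\delta$. If $s$ and $t$ are the least and the largest index of a nonzero block of $\mathbf f$, then $\mathrm{ord}_\delta(\mathbf f)=s$, $\deg_\delta(\mathbf f)=t$, and the $\delta$-span of $\mathbf f$ is $t-s$ (by convention the $\delta$-span of $\mathbf 0$ is $0$). Put $\Delta(\mathbf f,\mathbf g)=[\deg_\delta(\mathbf g)-\mathrm{ord}_\delta(\mathbf g)]-[\deg_\delta(\mathbf f)-\mathrm{ord}_\delta(\mathbf f)]$. A sequence $\{h_\delta\}_{\delta=0}^\infty$ in $\mathbb Z_2[z^\pm]$ is \emph{$(A,p)$-periodic} ($A\ge 0$, $p\ge 1$) if there are integers $s\le t$, bit strings $n_s,\dots,n_t$ of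 length $2A+1$ and bit strings $p_{s+1},\dots,p_t$ of length $p$ such that for all sufficiently large $\delta$ the string $$n_s\circ p_{s+1}^{(\delta-2A-1)}\circ n_{s+1}\circ\dots\circ p_t^{(\delta-2A-1)}\circ n_t$$ lists consecutive coefficients of $h_\delta$ in increasing order of exponents, the last one being that of $z^{t\delta+A}$, and all other coefficients of $h_\delta$ are $0$. Here $w^{(k)}$ is the initial segment of length $k$ of $w^k$. For a polynomial $F\in\mathbb Z_2[z]$ with $F(0)\ne0$, the division-by-$F$ automaton has as states the polynomials of degree less than $\deg F$, and transitions $s\xrightarrow{\,b\,}(sz+b)\bmod F$ for $b\in\{0,1\}$. For a nonzero $h\in\mathbb Z_2[z^\pm]$, let $F$ be the polynomial with nonzero constant term obtained from $h$ by multiplication with a power of $z$; $P_h$ denotes any integer $P\ge1$ such that, for every bit string $w$ and every state $s$ of the division-by-$F$ automaton, the chain of transitions that starts at $s$ and is labelled by $w^{P}$ ends at $s$. (For instance, the order of the finite group of permutations of the states generated by the two transitions is such an integer.) \textbf{Theorem.} Let $\mathbf f$ be a nontrivial $\delta$-parametric polynomial such that $\{\mathbf f_\delta\}_{\delta=0}^\infty$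 is $(A,1)$-periodic, and let $\mathbf g$ be a $\delta$-parametric polynomial such that $\{\mathbf g_\delta\}_{\delta=0}^\infty$ is $(B,1)$-periodic, where $A\le B$. Let $\Delta=\Delta(\mathbf f,\mathbf g)$, $t=\deg_\delta(\mathbf f)$, and let $P=P_{f_t}$ be as above. (a) If $\Delta<0$, then there is an integer $\delta\ge0$ with $\mathbf f_\delta\mid\mathbf g_\delta$ in $\mathbb Z_2[z^\pm]$ if and only if there is one with $0\le\delta\le 2B+2A$. (b) If $\Delta\ge0$, then there is an integer $\delta\ge0$ with $\mathbf f_\delta\mid\mathbf g_\delta$ in $\mathbb Z_2[z^\pm]$ if and only if there is one with $0\le\delta\le P^{\Delta}+2(B+4A\Delta)+4A+1$. -/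

import Mathlib

open scoped LaurentPolynomial Polynomial

noncomputable section

namespace DivPlus

/-- Laurent polynomials over the field with two elements. -/
abbrev L : Type := (ZMod 2)[T;T⁻¹]

/-- The order of a nonzero Laurent polynomial: the least exponent with a nonzero coefficient
(the value at `0` is an unused default). -/
def ord (h : L) : ℤ :=
  if hs : h.coeff.support.Nonempty then h.coeff.support.min' hs else 0

/-- The ordinary polynomial `z ^ (-ord h) * h`, with nonzero constant term when `h ≠ 0`. -/
def normalize (h : L) : (ZMod 2)[X] :=
  LaurentPolynomial.trunc (h * LaurentPolynomial.T (-ord h))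

/-- A `δ`-parametric polynomial `∑ i, f i * z ^ (i * δ)`, given by its finitely many nonzero
blocks `f i`. -/
abbrev ParamPoly : Type := ℤ →₀ L

/-- Instantiation: substituting an integer for the parameter `δ`. -/
def ParamPoly.inst (f : ParamPoly) (δ : ℤ) : L :=
  f.sum fun i fi => fi * LaurentPolynomial.T (i * δ)

/-- The `δ`-degree: the largest index of a nonzero block (by convention `0` for `f = 0`). -/
def ParamPoly.degδ (f : ParamPoly) : ℤ :=
  if hs : f.support.Nonempty then f.support.max' hs else 0

/-- The `δ`-order: the least index of a nonzero block (by convention `0` for `f = 0`). -/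
def ParamPoly.ordδ (f : ParamPoly) : ℤ :=
  if hs : f.support.Nonempty then f.support.min' hs else 0

/-- The difference of the `δ`-spans of `g` and `f`. -/
def spanDiff (f g : ParamPoly) : ℤ :=
  (g.degδ - g.ordδ) - (f.degδ - f.ordδ)

/-- Positive divisibility: some `δ ≥ 0` is a witness of `f_δ ∣ g_δ`. -/
def DIVPlus (f g : ParamPoly) : Prop :=
  ∃ δ : ℤ, 0 ≤ δ ∧ f.inst δ ∣ g.inst δ

/-! ### Piecewise periodic sequences -/

/-- `(D, w)` is a (possibly non-strict) presentation of `h`: the bit string `w`, read from left to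
right, lists consecutive coefficients of `h` in increasing order of exponents, the last one being
that of `z ^ D`; all other coefficients vanish. -/
def IsPres (h : L) (D : ℤ) (w : List (ZMod 2)) : Prop :=
  h = ∑ k : Fin w.length,
    LaurentPolynomial.C (w.get k) * LaurentPolynomial.T (D - w.length + 1 + (k : ℤ))

/-- The initial segment of length `k` of `w ^ k`. -/
def initSeg (w : List (ZMod 2)) (k : ℕ) : List (ZMod 2) :=
  (List.replicate k w).flatten.take k

/-- The string
`n_s ∘ p_{s+1}^{(m)} ∘ n_{s+1} ∘ p_{s+2}^{(m)} ∘ ⋯ ∘ p_{s+k}^{(m)} ∘ n_{s+k}`. -/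
def pwpString (n p : ℤ → List (ZMod 2)) (s : ℤ) (m : ℕ) : ℕ → List (ZMod 2)
  | 0 => n s
  | k + 1 => pwpString n p s m k ++ initSeg (p (s + (k + 1 : ℕ))) m ++ n (s + (k + 1 : ℕ))

/-- `(A, p)`-periodic (that is, piecewise periodic) sequences of Laurent polynomials. -/
def IsPWP (A p : ℕ) (h : ℕ → L) : Prop :=
  0 < p ∧ ∃ s t : ℤ, s ≤ t ∧ ∃ n per : ℤ → List (ZMod 2),
    (∀ i, s ≤ i → i ≤ t → (n i).length = 2 * A + 1) ∧
    (∀ i, s < i → i ≤ t → (per i).length = p) ∧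
    ∃ N : ℕ, 2 * A + 1 ≤ N ∧ ∀ δ : ℕ, N ≤ δ →
      IsPres (h δ) (δ * t + A) (pwpString n per s (δ - (2 * A + 1)) (t - s).toNat)

/-! ### The division automaton and its return constants -/

/-- The states of the division-by-`F` automaton. -/
abbrev State (F : (ZMod 2)[X]) : Type := {s : (ZMod 2)[X] // s.degree < F.degree}

/-- The state reached from `s` by the transition labelled `b`. -/
def step (F s : (ZMod 2)[X]) (b : ZMod 2) : (ZMod 2)[X] :=
  (s * Polynomial.X + Polynomial.C b) % F

/-- The final state of the transition chain that starts at `s` and is labelled by `w`. -/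
def run (F s : (ZMod 2)[X]) (w : List (ZMod 2)) : (ZMod 2)[X] :=
  w.foldl (step F) s

/-- `P` is a return constant of `F`: a positive integer such that for every bit string `w` and
every state `s`, the chain that starts at `s` and is labelled by `w ^ P` returns to `s`. -/
def IsReturnConst (F : (ZMod 2)[X]) (P : ℕ) : Prop :=
  0 < P ∧ ∀ (w : List (ZMod 2)) (s : State F), run F s (List.replicate P w).flatten = s

/-! The group generated by the transitions is finite, and its order is a return constant, so that
return constants exist for every polynomial with nonzero constant term. -/

instance finite_state (F : (ZMod 2)[X]) : Finite (State F) := by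
  have : Finite (Polynomial.degreeLT (ZMod 2) F.natDegree) :=
    Finite.of_equiv _ (Polynomial.degreeLTEquiv (ZMod 2) F.natDegree).symm.toEquiv
  by_cases hF : F = 0
  · subst hF
    have : IsEmpty (State 0) := ⟨fun s => by simpa using s.2⟩
    infer_instance
  · refine Finite.of_injective
      (fun s : State F => (⟨s.1, Polynomial.mem_degreeLT.2
        (by rw [← Polynomial.degree_eq_natDegree hF]; exact s.2)⟩ :
          Polynomial.degreeLT (ZMod 2) F.natDegree)) ?_
    intro a b hab
    exact Subtype.ext (Subtype.mk.inj hab)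

theorem ne_zero_of_coeff {F : (ZMod 2)[X]} (hF : F.coeff 0 ≠ 0) : F ≠ 0 := by
  rintro rfl
  simp at hF

/-- The transition labelled `b`, as a map on states. -/
def stepState (F : (ZMod 2)[X]) (hF : F.coeff 0 ≠ 0) (b : ZMod 2) (s : State F) : State F :=
  ⟨step F s b, EuclideanDomain.mod_lt _ (ne_zero_of_coeff hF)⟩

theorem stepState_bijective (F : (ZMod 2)[X]) (hF : F.coeff 0 ≠ 0) (b : ZMod 2) :
    Function.Bijective (stepState F hF b) := by
  refine Finite.injective_iff_bijective.1 ?_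
  intro s t hst
  have h1 : (s.1 * Polynomial.X + Polynomial.C b) % F
      = (t.1 * Polynomial.X + Polynomial.C b) % F := congrArg Subtype.val hst
  have h2 : F ∣ (s.1 - t.1) * Polynomial.X := by
    have h3 := (EuclideanDomain.mod_eq_zero (a := (s.1 * Polynomial.X + Polynomial.C b) -
      (t.1 * Polynomial.X + Polynomial.C b)) (b := F)).1 (by
        rw [Polynomial.sub_mod, h1, sub_self])
    convert h3 using 1
    ring
  have hcop : IsCoprime F (Polynomial.X : (ZMod 2)[X]) := by
    refine (Polynomial.irreducible_X.coprime_iff_not_dvd.2 ?_).symm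
    rwa [Polynomial.X_dvd_iff]
  have h4 : F ∣ s.1 - t.1 := hcop.dvd_of_dvd_mul_right h2
  have h5 : s.1 - t.1 = 0 := Polynomial.eq_zero_of_dvd_of_degree_lt h4
    (lt_of_le_of_lt (Polynomial.degree_sub_le _ _) (max_lt s.2 t.2))
  exact Subtype.ext (sub_eq_zero.1 h5)

/-- The finite group generated by the two transitions of the automaton. -/
def transitionGroup (F : (ZMod 2)[X]) (hF : F.coeff 0 ≠ 0) : Subgroup (Equiv.Perm (State F)) :=
  Subgroup.closure (Set.range fun b => Equiv.ofBijective _ (stepState_bijective F hF b))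

theorem isReturnConst_card_transitionGroup (F : (ZMod 2)[X]) (hF : F.coeff 0 ≠ 0) :
    IsReturnConst F (Nat.card (transitionGroup F hF)) := by
  refine ⟨Nat.card_pos, fun w s => ?_⟩
  have key : ∀ w : List (ZMod 2), ∃ σ : transitionGroup F hF,
      ∀ s : State F, run F s w = (σ.1 s : State F).1 := by
    intro w
    induction w with
    | nil => exact ⟨1, fun s => rfl⟩
    | cons b w ih =>
      obtain ⟨σ, hσ⟩ := ih
      refine ⟨σ * ⟨Equiv.ofBijective _ (stepState_bijective F hF b),
        Subgroup.subset_closure ⟨b, rfl⟩⟩, fun s => ?_⟩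
      exact hσ (stepState F hF b s)
  obtain ⟨σ, hσ⟩ := key w
  have hpow : ∀ (k : ℕ) (s : State F),
      run F s (List.replicate k w).flatten = ((σ ^ k).1 s : State F).1 := by
    intro k
    induction k with
    | zero => intro s; rfl
    | succ k ih =>
      intro s
      rw [List.replicate_succ, List.flatten_cons, run, List.foldl_append]
      change run F (run F s w) _ = _
      rw [hσ s, ih, pow_succ]
      rfl
  rw [hpow, pow_card_eq_one']
  rfl

theorem coeff_trunc (h : L) (n : ℕ) : (LaurentPolynomial.trunc h).coeff n = h.coeff (n : ℤ) := by
  induction h using LaurentPolynomial.induction_on' with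
  | add p q hp hq => simp [hp, hq]
  | C_mul_T m a =>
    rw [LaurentPolynomial.trunc_C_mul_T, ← LaurentPolynomial.single_eq_C_mul_T,
      AddMonoidAlgebra.coeff_single, Finsupp.single_apply]
    split_ifs with h1 h2 h2
    · rw [Polynomial.coeff_monomial, if_pos (by omega)]
    · rw [Polynomial.coeff_monomial, if_neg (by omega)]
    · omega
    · simp

theorem coeff_normalize (h : L) (n : ℕ) : (normalize h).coeff n = h.coeff (n + ord h) := by
  rw [normalize, coeff_trunc, LaurentPolynomial.T,
    AddMonoidAlgebra.coeff_mul_single_eq_coeff_mul (n + ord h : ℤ) (by intros; omega), mul_one]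

theorem coeff_normalize_ne_zero (h : L) (hh : h ≠ 0) : (normalize h).coeff 0 ≠ 0 := by
  have hs : h.coeff.support.Nonempty := by
    rw [Finsupp.support_nonempty_iff]
    intro h0
    exact hh (LaurentPolynomial.ext fun a => by simp [h0])
  have hm := h.coeff.support.min'_mem hs
  have ho : ord h = h.coeff.support.min' hs := by simp [ord, hs]
  rw [← ho, Finsupp.mem_support_iff] at hm
  rw [coeff_normalize]
  simpa using hm

end DivPlus

end

namespace DivPlus

open LaurentPolynomial (T)

/-! Regard `f` and `g` as polynomials in `z ^ δ` whose coefficients are the blocks. Periodicity with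
period `1` confines the exponents of the blocks to `[-A, A]` and `[-B, B]` (`IsPWP.blockBound`), so
for large `δ` the blocks do not overlap. Then the exponent span of `f_δ` is about `δ` times the
`δ`-span of `f`, and a nonzero `h` of smaller `δ`-span cannot have `h_δ` divisible by `f_δ`
(`eq_zero_of_dvd`). This settles (a): a large witness forces `g = 0`.

For (b), let `d = Δ` and let `a` be the leading block of `f`. Pseudo-division (`exists_pseudoDiv`)
gives `a ^ (d + 1) * g_δ = Q_δ * f_δ + r_δ` for all `δ`, where `r` has smaller `δ`-span than `f`.
One large witness forces `r = 0`, and the identity then holds at every `δ` without remainder. Hence,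
wherever `f_δ ≠ 0`, the condition `f_δ ∣ g_δ` means `a ^ (d + 1) ∣ Q_δ`. The last quotient block
also turns out to be divisible by `a`, which lowers the exponent to `d`. The return constant gives
`a ^ d ∣ z ^ (P ^ d) - 1` (`IsReturnConst.pow_dvd_T_sub_one`), so this condition has period `P ^ d`
in `δ`, and large witnesses can be lowered by `P ^ d` (`dvd_inst_sub_of_dvd`). -/

/-! ### Coefficients and exponent spans of Laurent polynomials -/

theorem coeff_mul_T (h : L) (m e : ℤ) : (h * T m).coeff e = h.coeff (e - m) := by
  rw [LaurentPolynomial.T,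
    AddMonoidAlgebra.coeff_mul_single_eq_coeff_mul (e - m) (by intros; omega), mul_one]

theorem exists_coeff_ne_zero {a : L} (ha : a ≠ 0) : ∃ e, a.coeff e ≠ 0 := by
  by_contra! h
  exact ha (LaurentPolynomial.ext fun e => by simp [h])

theorem exists_coeff_mul {a b : L} {e : ℤ} (h : (a * b).coeff e ≠ 0) :
    ∃ x y, a.coeff x ≠ 0 ∧ b.coeff y ≠ 0 ∧ x + y = e := by
  rw [AddMonoidAlgebra.coeff_mul] at h
  obtain ⟨x, hx, h⟩ := Finset.exists_ne_zero_of_sum_ne_zero h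
  obtain ⟨y, hy, h⟩ := Finset.exists_ne_zero_of_sum_ne_zero h
  exact ⟨x, y, Finsupp.mem_support_iff.1 hx, Finsupp.mem_support_iff.1 hy, by
    by_contra hne; simp [hne] at h⟩

/-- The exponent span of a nonzero product is at least that of each factor. -/
theorem span_mul {a b : L} (hb : b ≠ 0) {x x' : ℤ}
    (hx : a.coeff x ≠ 0) (hx' : a.coeff x' ≠ 0) :
    ∃ w w', (a * b).coeff w ≠ 0 ∧ (a * b).coeff w' ≠ 0 ∧ x - x' ≤ w - w' := by
  have hA : a.coeff.support.Nonempty := ⟨x, Finsupp.mem_support_iff.2 hx⟩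
  have hB : b.coeff.support.Nonempty := by
    obtain ⟨e, he⟩ := exists_coeff_ne_zero hb
    exact ⟨e, Finsupp.mem_support_iff.2 he⟩
  -- The two greatest exponents, like the two least, have a sum attained only once, so nothing
  -- cancels there.
  have key : ∀ x₀ y₀, x₀ ∈ a.coeff.support → y₀ ∈ b.coeff.support →
      UniqueAdd a.coeff.support b.coeff.support x₀ y₀ → (a * b).coeff (x₀ + y₀) ≠ 0 := by
    intro x₀ y₀ h1 h2 h
    rw [AddMonoidAlgebra.coeff_mul_add_of_uniqueAdd h]
    exact mul_ne_zero (Finsupp.mem_support_iff.1 h1) (Finsupp.mem_support_iff.1 h2)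
  refine ⟨_, _, key _ _ (a.coeff.support.max'_mem hA) (b.coeff.support.max'_mem hB) ?_,
    key _ _ (a.coeff.support.min'_mem hA) (b.coeff.support.min'_mem hB) ?_, ?_⟩
  · intro c d hc hd h
    have := Finset.le_max' _ _ hc
    have := Finset.le_max' _ _ hd
    omega
  · intro c d hc hd h
    have := Finset.min'_le _ _ hc
    have := Finset.min'_le _ _ hd
    omega
  · have := Finset.le_max' _ _ (Finsupp.mem_support_iff.2 hx)
    have := Finset.min'_le _ _ (Finsupp.mem_support_iff.2 hx')
    have := Finset.min'_le_max' _ hB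
    omega

theorem toLaurent_normalize (h : L) : (normalize h).toLaurent * T (ord h) = h := by
  refine LaurentPolynomial.ext fun e => ?_
  rw [coeff_mul_T, LaurentPolynomial.coeff_toLaurent]
  by_cases he : 0 ≤ e - ord h
  · obtain ⟨n, hn⟩ := Int.eq_ofNat_of_zero_le he
    have : e = n + ord h := by omega
    subst this
    rw [hn]
    have := Finsupp.mapDomain_apply Nat.cast_injective (normalize h).toFinsupp.coeff (n) (β := ℤ)
    refine this.trans ?_
    exact coeff_normalize h n
  · rw [Finsupp.mapDomain_of_notMem_range]
    · by_contra hne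
      have hm : e ∈ h.coeff.support := Finsupp.mem_support_iff.2 (Ne.symm hne)
      have h2 := Finset.min'_le _ _ hm
      rw [ord, dif_pos ⟨e, hm⟩] at he
      omega
    · rintro ⟨n, hn⟩
      simp at hn
      omega

/-! ### Instantiation -/

theorem inst_add (f g : ParamPoly) (δ : ℤ) : (f + g).inst δ = f.inst δ + g.inst δ :=
  Finsupp.sum_add_index' (by simp) (by intros; rw [add_mul])

theorem inst_sub (f g : ParamPoly) (δ : ℤ) : (f - g).inst δ = f.inst δ - g.inst δ := by
  rw [eq_sub_iff_add_eq, ← inst_add, sub_add_cancel]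

theorem inst_smul (c : L) (f : ParamPoly) (δ : ℤ) : (c • f).inst δ = c * f.inst δ := by
  rw [ParamPoly.inst, Finsupp.sum_smul_index' (by simp), ParamPoly.inst, Finsupp.mul_sum]
  simp [mul_assoc]

theorem inst_single (i : ℤ) (c : L) (δ : ℤ) :
    ParamPoly.inst (Finsupp.single i c) δ = c * T (i * δ) :=
  Finsupp.sum_single_index (by simp)

theorem inst_zero (δ : ℤ) : ParamPoly.inst 0 δ = 0 := Finsupp.sum_zero_index

/-- Multiplication by `z ^ (j * δ)`. -/
noncomputable def shift (j : ℤ) (f : ParamPoly) : ParamPoly :=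
  Finsupp.equivMapDomain (Equiv.addRight j) f

theorem shift_apply (j : ℤ) (f : ParamPoly) (i : ℤ) : shift j f i = f (i - j) := by
  simp [shift, Finsupp.equivMapDomain_apply, sub_eq_add_neg]

theorem inst_shift (j : ℤ) (f : ParamPoly) (δ : ℤ) :
    (shift j f).inst δ = T (j * δ) * f.inst δ := by
  rw [ParamPoly.inst, shift, Finsupp.sum_equivMapDomain, ParamPoly.inst, Finsupp.mul_sum]
  refine Finsupp.sum_congr fun i _ => ?_
  rw [Equiv.coe_addRight, add_mul, LaurentPolynomial.T_add]
  ring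

theorem coeff_inst (f : ParamPoly) (δ e : ℤ) :
    (f.inst δ).coeff e = f.sum fun i fi => fi.coeff (e - i * δ) := by
  rw [ParamPoly.inst, Finsupp.sum, AddMonoidAlgebra.coeff_sum, Finsupp.finsetSum_apply]
  exact Finset.sum_congr rfl fun i _ => coeff_mul_T _ _ _

/-- All blocks have their exponents in `[-C, C]`. -/
def BlockBound (f : ParamPoly) (C : ℤ) : Prop := ∀ i e, (f i).coeff e ≠ 0 → |e| ≤ C

theorem exists_blockBound (f : ParamPoly) : ∃ C, BlockBound f C := by
  refine ⟨∑ i ∈ f.support, ∑ e ∈ (f i).coeff.support, |e|, fun i e he => ?_⟩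
  have h1 : e ∈ (f i).coeff.support := Finsupp.mem_support_iff.2 he
  have h2 : i ∈ f.support := Finsupp.mem_support_iff.2 fun h => by simp [h] at he
  refine (Finset.single_le_sum (f := fun e : ℤ => |e|) (fun _ _ => abs_nonneg _) h1).trans ?_
  exact Finset.single_le_sum (f := fun i => ∑ e ∈ (f i).coeff.support, |e|)
    (fun _ _ => Finset.sum_nonneg fun _ _ => abs_nonneg _) h2

/-- Every other block is centred at distance at least `δ` from `i * δ`, and `δ - |e| > C` puts it
out of reach. -/
theorem coeff_inst_near {f : ParamPoly} {C δ : ℤ} (hf : BlockBound f C) (i e : ℤ)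
    (he : |e| + C < δ) : (f.inst δ).coeff (i * δ + e) = (f i).coeff e := by
  rw [coeff_inst, Finsupp.sum_of_support_subset (s := insert i f.support) _ (by simp) _ (by simp),
    Finset.sum_eq_single i _ (by simp)]
  · ring_nf
  · intro j _ hj
    by_contra hne
    have h1 := hf j _ hne
    rw [abs_le] at h1
    have h2 := abs_le.1 (le_refl |e|)
    have hC : 0 ≤ C := by linarith
    have hδ : 0 < δ := by linarith [abs_nonneg e]
    rcases lt_or_gt_of_ne hj with h | h
    · nlinarith
    · nlinarith

theorem exists_of_coeff_inst {f : ParamPoly} {δ n : ℤ} (h : (f.inst δ).coeff n ≠ 0) :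
    ∃ i, (f i).coeff (n - i * δ) ≠ 0 := by
  rw [coeff_inst] at h
  obtain ⟨i, _, h⟩ := Finset.exists_ne_zero_of_sum_ne_zero h
  exact ⟨i, h⟩

theorem inst_ne_zero {f : ParamPoly} {C δ : ℤ} (hf : BlockBound f C) (h0 : f ≠ 0)
    (hδ : 2 * C < δ) : f.inst δ ≠ 0 := by
  obtain ⟨i, hi⟩ := Finsupp.ne_iff.1 h0
  obtain ⟨e, he⟩ := exists_coeff_ne_zero hi
  have h1 := coeff_inst_near hf i e (δ := δ) (by linarith [hf i e he])
  intro h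
  rw [h] at h1
  exact he (by simpa using h1.symm)

/-- If `f_δ ∣ h_δ` for a large `δ`, and `h` has a smaller `δ`-span than `f`, then `h = 0`. -/
theorem eq_zero_of_dvd {f h : ParamPoly} {A C δ s t b c : ℤ} (hf : BlockBound f A)
    (hh : BlockBound h C) (hs : f s ≠ 0) (ht : f t ≠ 0)
    (hr : ∀ i, h i ≠ 0 → b ≤ i ∧ i ≤ c) (hlt : c - b < t - s)
    (hδ : 2 * A + 2 * C < δ) (hd : f.inst δ ∣ h.inst δ) : h = 0 := by
  by_contra h0
  have hA : 0 ≤ A := by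
    obtain ⟨e, he⟩ := exists_coeff_ne_zero hs
    exact (abs_nonneg e).trans (hf s e he)
  have hC : 0 ≤ C := by
    obtain ⟨i, hi⟩ := Finsupp.ne_iff.1 h0
    obtain ⟨e, he⟩ := exists_coeff_ne_zero hi
    exact (abs_nonneg e).trans (hh i e he)
  obtain ⟨x, hx⟩ := exists_coeff_ne_zero ht
  obtain ⟨x', hx'⟩ := exists_coeff_ne_zero hs
  have bx := hf t x hx
  have bx' := hf s x' hx'
  rw [← coeff_inst_near hf t x (δ := δ) (by linarith)] at hx
  rw [← coeff_inst_near hf s x' (δ := δ) (by linarith)] at hx'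
  have h1 := inst_ne_zero hh h0 (δ := δ) (by linarith)
  obtain ⟨q, hq⟩ := hd
  have hq0 : q ≠ 0 := by
    rintro rfl
    exact h1 (by rw [hq, mul_zero])
  obtain ⟨w, w', hw, hw', hle⟩ := span_mul hq0 hx hx'
  rw [← hq] at hw hw'
  obtain ⟨i, hi⟩ := exists_of_coeff_inst hw
  obtain ⟨j, hj⟩ := exists_of_coeff_inst hw'
  have bi := abs_le.1 (hh _ _ hi)
  have bj := abs_le.1 (hh _ _ hj)
  have ri := hr i fun h => by simp [h] at hi
  have rj := hr j fun h => by simp [h] at hj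
  rw [abs_le] at bx bx'
  -- The span of `f_δ` is at least `(t - s) * δ - 2 * A`, and that of `h_δ` at most `(t - s - 1) * δ
  -- + 2 * C`. Comparison gives `δ ≤ 2 * A + 2 * C`.
  have : (i - j) * δ ≤ (t - s - 1) * δ := by
    apply mul_le_mul_of_nonneg_right <;> linarith
  nlinarith

/-! ### Pseudo-division in the parameter -/

/-- One step of the division of `r` by `f` in the variable `z ^ δ`. -/
theorem exists_pseudoDiv_step {f r : ParamPoly} {A C s t b : ℤ} {k : ℕ} (hf : BlockBound f A)
    (hr : BlockBound r C) (hfs : ∀ i, f i ≠ 0 → s ≤ i ∧ i ≤ t)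
    (hrs : ∀ i, r i ≠ 0 → b ≤ i ∧ i ≤ b + (t - s) + k) :
    ∃ (j : ℤ) (c : L) (r' : ParamPoly), BlockBound r' (C + A) ∧
      (∀ i, r' i ≠ 0 → b ≤ i ∧ i ≤ b + (t - s) + k - 1) ∧
      ∀ δ, f t * r.inst δ = c * T (j * δ) * f.inst δ + r'.inst δ := by
  -- The shift moves the top block of `f` to index `b + (t - s) + k`, where the two products cancel.
  -- Its lowest block lands no lower than `b + k`.
  refine ⟨b - s + k, r (b + (t - s) + k),
    f t • r - r (b + (t - s) + k) • shift (b - s + k) f, ?_, ?_, fun δ => ?_⟩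
  · intro i e he
    rw [Finsupp.sub_apply, Finsupp.smul_apply, Finsupp.smul_apply, smul_eq_mul, smul_eq_mul,
      shift_apply, AddMonoidAlgebra.coeff_sub, Finsupp.sub_apply] at he
    have : (f t * r i).coeff e ≠ 0 ∨
        (r (b + (t - s) + k) * f (i - (b - s + k))).coeff e ≠ 0 := by
      by_contra! h
      simp [h] at he
    rcases this with h | h <;> obtain ⟨x, y, hx, hy, rfl⟩ := exists_coeff_mul h
    · linarith [abs_add_le x y, hf _ _ hx, hr _ _ hy]
    · linarith [abs_add_le x y, hr _ _ hx, hf _ _ hy]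
  · intro i hi
    rw [Finsupp.sub_apply, Finsupp.smul_apply, Finsupp.smul_apply, smul_eq_mul, smul_eq_mul,
      shift_apply] at hi
    have hne : i ≠ b + (t - s) + k := by
      rintro rfl
      apply hi
      rw [show b + (t - s) + k - (b - s + k) = t by ring]
      ring
    have : r i ≠ 0 ∨ f (i - (b - s + k)) ≠ 0 := by
      by_contra! h
      simp [h] at hi
    rcases this with h | h
    · have := hrs i h
      omega
    · have := hfs _ h
      omega
  · rw [inst_sub, inst_smul, inst_smul, inst_shift]
    ring

/-- Each step costs one factor `f t`, lowers the upper index bound by one and widens the blocks by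
at most `A`. -/
theorem exists_pseudoDiv {f g : ParamPoly} {A B s t b : ℤ} {d : ℕ} (hf : BlockBound f A)
    (hg : BlockBound g B) (hfs : ∀ i, f i ≠ 0 → s ≤ i ∧ i ≤ t)
    (hgs : ∀ i, g i ≠ 0 → b ≤ i ∧ i ≤ b + (t - s) + d) (n : ℕ) (hn : n ≤ d) :
    ∃ q r : ParamPoly, BlockBound r (B + n * A) ∧
      (∀ i, r i ≠ 0 → b ≤ i ∧ i ≤ b + (t - s) + (d - n : ℕ)) ∧
      ∀ δ, f t ^ n * g.inst δ = q.inst δ * f.inst δ + r.inst δ := by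
  induction n with
  | zero => exact ⟨0, g, by simpa using hg, by simpa using hgs, fun δ => by simp [inst_zero]⟩
  | succ n ih =>
    obtain ⟨q, r, hr, hrs, h⟩ := ih (by omega)
    obtain ⟨j, c, r', hr', hrs', h'⟩ := exists_pseudoDiv_step hf hr hfs hrs
    refine ⟨f t • q + Finsupp.single j c, r', ?_, ?_, fun δ => ?_⟩
    · convert hr' using 1
      push_cast
      ring
    · intro i hi
      have := hrs' i hi
      omega
    · rw [pow_succ', mul_assoc, h, mul_add, h', inst_add, inst_smul, inst_single]
      ring

/-! ### Return constants -/

theorem run_append (F s : (ZMod 2)[X]) (v w : List (ZMod 2)) :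
    run F s (v ++ w) = run F (run F s v) w := List.foldl_append

theorem dvd_run_sub_zeros (F s : (ZMod 2)[X]) (n : ℕ) :
    F ∣ s * Polynomial.X ^ n - run F s (List.replicate n 0) := by
  induction n generalizing s with
  | zero => simp [run]
  | succ n ih =>
    have h1 := ih (step F s 0)
    have h2 : F ∣ s * Polynomial.X - step F s 0 := by
      have := EuclideanDomain.div_add_mod (s * Polynomial.X) F
      refine ⟨s * Polynomial.X / F, ?_⟩
      rw [step, map_zero, add_zero]
      linear_combination -this
    have h3 := dvd_add (h2.mul_right (Polynomial.X ^ n)) h1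
    convert h3 using 1
    rw [List.replicate_succ, run, List.foldl_cons, ← run]
    ring

/-- The word `0 ⋯ 0 1` of length `n + 1` acts as `s ↦ s * z ^ (n + 1) + 1`. -/
theorem dvd_run_sub_zeros_one (F s : (ZMod 2)[X]) (n : ℕ) :
    F ∣ s * Polynomial.X ^ (n + 1) + 1 - run F s (List.replicate n 0 ++ [1]) := by
  have h1 := dvd_run_sub_zeros F s n
  rw [run_append]
  set u := run F s (List.replicate n 0)
  have := EuclideanDomain.div_add_mod (u * Polynomial.X + 1) F
  have h3 : F ∣ u * Polynomial.X + 1 - run F u [1] := by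
    refine ⟨(u * Polynomial.X + 1) / F, ?_⟩
    rw [run, List.foldl_cons, List.foldl_nil, step, map_one]
    linear_combination -this
  have h4 := dvd_add (h1.mul_right Polynomial.X) h3
  convert h4 using 1
  ring

theorem dvd_geom_sub_run (F : (ZMod 2)[X]) (n k : ℕ) :
    F ∣ (∑ i ∈ Finset.range k, (Polynomial.X ^ (n + 1)) ^ i) -
      run F 0 (List.replicate k (List.replicate n 0 ++ [1])).flatten := by
  induction k with
  | zero => simp [run]
  | succ k ih =>
    rw [List.replicate_succ', List.flatten_append, List.flatten_singleton, run_append]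
    set u := run F 0 (List.replicate k (List.replicate n 0 ++ [1])).flatten
    have h := dvd_add (ih.mul_right (Polynomial.X ^ (n + 1))) (dvd_run_sub_zeros_one F u n)
    convert h using 1
    rw [Finset.sum_range_succ', pow_zero]
    simp only [pow_succ _ (_ : ℕ), ← Finset.sum_mul]
    ring

/-- The word `0 ⋯ 0 1` of length `l`, repeated `P` times from state `0`, computes the geometric sum
modulo `F`; the return to `0` makes it vanish. -/
theorem IsReturnConst.dvd_geom_sum {F : (ZMod 2)[X]} {P : ℕ} (hP : IsReturnConst F P)
    (hF : F ≠ 0) {l : ℕ} (hl : 0 < l) :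
    F ∣ ∑ i ∈ Finset.range P, (Polynomial.X ^ l) ^ i := by
  obtain ⟨n, rfl⟩ := Nat.exists_eq_succ_of_ne_zero hl.ne'
  have h := dvd_geom_sub_run F n P
  rwa [hP.2 _ ⟨0, by simpa [bot_lt_iff_ne_bot] using hF⟩, sub_zero] at h

/-- Passing from `P ^ k` to `P ^ (k + 1)` multiplies `z ^ (P ^ k) - 1` by a geometric sum with `P`
terms, which contributes one more factor `F`. -/
theorem IsReturnConst.pow_dvd_X_pow_sub_one {F : (ZMod 2)[X]} {P : ℕ} (hP : IsReturnConst F P)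
    (hF : F ≠ 0) (k : ℕ) : F ^ k ∣ Polynomial.X ^ P ^ k - 1 := by
  induction k with
  | zero => simp
  | succ k ih =>
    rw [pow_succ P, pow_mul, ← mul_geom_sum, pow_succ]
    exact mul_dvd_mul ih (hP.dvd_geom_sum hF (pow_pos hP.1 k))

theorem IsReturnConst.pow_dvd_T_sub_one {h : L} {P : ℕ} (hP : IsReturnConst (normalize h) P)
    (hh : h ≠ 0) (k : ℕ) : h ^ k ∣ T ((P ^ k : ℕ) : ℤ) - 1 := by
  have hF := ne_zero_of_coeff (coeff_normalize_ne_zero h hh)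
  have h1 := map_dvd Polynomial.toLaurent (hP.pow_dvd_X_pow_sub_one hF k)
  rw [map_sub, map_one, Polynomial.toLaurent_X_pow, map_pow] at h1
  rw [← toLaurent_normalize h, mul_pow]
  exact (((LaurentPolynomial.isUnit_T _).pow k).mul_right_dvd).2 h1

theorem dvd_T_mul_sub_one {a : L} {ε : ℤ} (h : a ∣ T ε - 1) (i : ℤ) : a ∣ T (i * ε) - 1 := by
  have hn : ∀ n : ℕ, a ∣ T (n * ε) - 1 := by
    intro n
    rw [← LaurentPolynomial.T_pow]
    exact h.trans (sub_one_dvd_pow_sub_one _ n)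
  obtain ⟨n, rfl | rfl⟩ := i.eq_nat_or_neg
  · exact hn n
  · have := (hn n).mul_right (-T (-n * ε))
    convert this using 1
    have h1 : (T (n * ε) : L) * T (-n * ε) = 1 := by
      rw [← LaurentPolynomial.T_add, ← LaurentPolynomial.T_zero]
      congr 1
      ring
    linear_combination h1

/-- If `z ^ ε` is `1` modulo `a`, then instantiations at `δ` and `δ - ε` agree modulo `a`. -/
theorem dvd_inst_sub {a : L} {ε : ℤ} (h : a ∣ T ε - 1) (q : ParamPoly) (δ : ℤ) :
    a ∣ q.inst δ - q.inst (δ - ε) := by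
  rw [ParamPoly.inst, ParamPoly.inst, Finsupp.sum, Finsupp.sum, ← Finset.sum_sub_distrib]
  refine Finset.dvd_sum fun i _ => ?_
  have h1 := (dvd_T_mul_sub_one h i).mul_left (q i * T (i * (δ - ε)))
  convert h1 using 1
  rw [show i * δ = i * (δ - ε) + i * ε by ring, LaurentPolynomial.T_add]
  ring

/-! ### Descent -/

theorem dvd_inst_sub_of_dvd {f g : ParamPoly} {A B s t b δ : ℤ} {d P : ℕ} (hf : BlockBound f A)
    (hg : BlockBound g B) (hfs : ∀ i, f i ≠ 0 → s ≤ i ∧ i ≤ t) (hs : f s ≠ 0) (ht : f t ≠ 0)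
    (hgs : ∀ i, g i ≠ 0 → b ≤ i ∧ i ≤ b + (t - s) + d) (hP : IsReturnConst (normalize (f t)) P)
    (hδ : 2 * A + 2 * (B + (d + 1) * A) < δ) (hd : f.inst δ ∣ g.inst δ) (hB : 0 ≤ B) :
    f.inst (δ - (P ^ d : ℕ)) ∣ g.inst (δ - (P ^ d : ℕ)) := by
  obtain ⟨q, r, hr, hrs, h⟩ := exists_pseudoDiv hf hg hfs hgs d le_rfl
  -- The last division step is kept separate because its quotient block `c` is needed explicitly
  -- below.
  obtain ⟨j, c, r', hr', hrs', h'⟩ := exists_pseudoDiv_step hf hr hfs hrs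
  have hA : 0 ≤ A := by
    obtain ⟨e, he⟩ := exists_coeff_ne_zero hs
    exact (abs_nonneg e).trans (hf s e he)
  have hfδ : f.inst δ ≠ 0 := by
    refine inst_ne_zero hf (fun h0 => hs (by simp [h0])) ?_
    nlinarith [mul_nonneg (by positivity : (0 : ℤ) ≤ d + 1) hA]
  have hr0 : r' = 0 := by
    refine eq_zero_of_dvd (C := B + (d + 1) * A) hf ?_ hs ht hrs' ?_ hδ ?_
    · convert hr' using 1
      ring
    · simp
      omega
    · have h1 : r'.inst δ = f t * (f t ^ d * g.inst δ)
          - (f t * q.inst δ + c * T (j * δ)) * f.inst δ := by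
        rw [h]
        linear_combination -(h' δ)
      rw [h1]
      exact dvd_sub ((hd.mul_left _).mul_left _) (dvd_mul_left _ _)
  -- Since `r'` vanishes as a parametric polynomial, the identity also holds at the lowered
  -- parameter.
  have key : ∀ δ, f t ^ (d + 1) * g.inst δ =
      (f t * q.inst δ + c * T (j * δ)) * f.inst δ := by
    intro δ
    have h1 := h' δ
    rw [hr0, inst_zero] at h1
    rw [pow_succ', mul_assoc, h]
    linear_combination h1
  obtain ⟨u, hu⟩ := hd
  have hq : f t * q.inst δ + c * T (j * δ) = f t ^ (d + 1) * u := by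
    refine mul_right_cancel₀ hfδ ?_
    rw [← key, hu]
    ring
  -- The block `c` does not depend on `δ`, so divisibility at the single given `δ` suffices. It
  -- saves one factor `f t`, giving period `P ^ d` instead of `P ^ (d + 1)`.
  obtain ⟨c', rfl⟩ : f t ∣ c := by
    refine ((LaurentPolynomial.isUnit_T (j * δ)).dvd_mul_right).1 ?_
    refine (dvd_add_right (dvd_mul_right (f t) (q.inst δ))).1 ?_
    rw [hq, pow_succ', mul_assoc]
    exact dvd_mul_right _ _
  have hQ : ∀ δ, (q + Finsupp.single j c').inst δ = q.inst δ + c' * T (j * δ) := by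
    intro δ
    rw [inst_add, inst_single]
  have h1 : f t ^ d ∣ (q + Finsupp.single j c').inst δ := by
    refine ⟨u, mul_left_cancel₀ ht ?_⟩
    rw [hQ]
    linear_combination hq
  obtain ⟨v, hv⟩ := (dvd_iff_dvd_of_dvd_sub
    (dvd_inst_sub (hP.pow_dvd_T_sub_one ht d) (q + Finsupp.single j c') δ)).1 h1
  refine ⟨v, mul_left_cancel₀ (pow_ne_zero (d + 1) ht) ?_⟩
  rw [key]
  rw [hQ] at hv
  linear_combination f t * f.inst (δ - (P ^ d : ℕ)) * hv

/-! ### Periodic sequences -/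

theorem IsPres.coeff_eq {h : L} {D : ℤ} {w : List (ZMod 2)} (hw : IsPres h D w) (e : ℤ) :
    h.coeff e = ∑ k : Fin w.length, if D - w.length + 1 + (k : ℤ) = e then w.get k else 0 := by
  rw [IsPres] at hw
  rw [hw, AddMonoidAlgebra.coeff_sum, Finsupp.finsetSum_apply]
  refine Finset.sum_congr rfl fun k _ => ?_
  rw [← LaurentPolynomial.single_eq_C_mul_T, AddMonoidAlgebra.coeff_single, Finsupp.single_apply]

theorem IsPres.coeff_add {h : L} {D : ℤ} {w : List (ZMod 2)} (hw : IsPres h D w) (n : ℕ) :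
    h.coeff (D - w.length + 1 + n) = w.getD n 0 := by
  rw [hw.coeff_eq]
  by_cases hn : n < w.length
  · rw [Finset.sum_eq_single ⟨n, hn⟩]
    · simp [hn]
    · intro k _ hk
      rw [if_neg]
      intro h
      apply hk
      ext
      simpa using h
    · simp
  · rw [List.getD_eq_default _ _ (by omega)]
    refine Finset.sum_eq_zero fun k _ => if_neg ?_
    have := k.2
    omega

theorem IsPres.exists_nat {h : L} {D : ℤ} {w : List (ZMod 2)} (hw : IsPres h D w) {e : ℤ}
    (he : h.coeff e ≠ 0) : ∃ n : ℕ, e = D - w.length + 1 + n := by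
  rw [hw.coeff_eq] at he
  obtain ⟨k, _, hk⟩ := Finset.exists_ne_zero_of_sum_ne_zero he
  exact ⟨k, by by_contra hne; exact hk (if_neg (Ne.symm hne))⟩

theorem initSeg_singleton (b : ZMod 2) (m : ℕ) : initSeg [b] m = List.replicate m b := by
  have : (List.replicate m [b]).flatten = List.replicate m b := by
    induction m with
    | zero => rfl
    | succ m ih => rw [List.replicate_succ, List.flatten_cons, ih, List.replicate_succ]; rfl
  rw [initSeg, this, List.take_of_length_le (by simp)]

theorem length_pwpString {n p : ℤ → List (ZMod 2)} {s : ℤ} {a m k : ℕ}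
    (hn : ∀ i, s ≤ i → i ≤ s + k → (n i).length = a)
    (hp : ∀ i, s < i → i ≤ s + k → (p i).length = 1) :
    (pwpString n p s m k).length = k * (m + a) + a := by
  induction k with
  | zero => simpa [pwpString] using hn s le_rfl (by simp)
  | succ k ih =>
    obtain ⟨b, hb⟩ := List.length_eq_one_iff.1 (hp (s + (k + 1 : ℕ)) (by omega) le_rfl)
    rw [pwpString, List.length_append, List.length_append, hb, initSeg_singleton,
      ih (fun i h1 h2 => hn i h1 (by omega)) (fun i h1 h2 => hp i h1 (by omega)),
      hn _ (by omega) le_rfl, List.length_replicate]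
    ring

/-- For period `1`, the string is constant between two consecutive nodes. -/
theorem getD_pwpString {n p : ℤ → List (ZMod 2)} {s : ℤ} {a m k : ℕ}
    (hn : ∀ i, s ≤ i → i ≤ s + k → (n i).length = a)
    (hp : ∀ i, s < i → i ≤ s + k → (p i).length = 1) (i : ℕ) {j j' : ℕ} (hj : j < m)
    (hj' : j' < m) :
    (pwpString n p s m k).getD (i * (m + a) + a + j) 0 =
      (pwpString n p s m k).getD (i * (m + a) + a + j') 0 := by
  have hlen := length_pwpString (m := m) hn hp
  induction k with
  | zero =>
    rw [List.getD_eq_default _ _ (by rw [hlen]; omega),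
      List.getD_eq_default _ _ (by rw [hlen]; omega)]
  | succ k ih =>
    have hn' : ∀ i, s ≤ i → i ≤ s + k → (n i).length = a := fun i h1 h2 => hn i h1 (by omega)
    have hp' : ∀ i, s < i → i ≤ s + k → (p i).length = 1 := fun i h1 h2 => hp i h1 (by omega)
    have hlen' := length_pwpString (m := m) hn' hp'
    rcases lt_trichotomy i k with h | rfl | h
    · have h1 : (i + 1) * (m + a) ≤ k * (m + a) := Nat.mul_le_mul_right _ h
      rw [add_mul, one_mul] at h1
      rw [pwpString, List.append_assoc, List.getD_append _ _ _ _ (by omega),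
        List.getD_append _ _ _ _ (by omega)]
      exact ih hn' hp' hlen'
    · obtain ⟨b, hb⟩ := List.length_eq_one_iff.1 (hp (s + (i + 1 : ℕ)) (by omega) le_rfl)
      have hval : ∀ x < m, (pwpString n p s m (i + 1)).getD (i * (m + a) + a + x) 0 = b := by
        intro x hx
        rw [pwpString, List.append_assoc, List.getD_append_right _ _ _ _ (by omega), hb,
          initSeg_singleton, List.getD_append _ _ _ _ (by rw [List.length_replicate]; omega),
          List.getD_replicate _ (by omega)]
      rw [hval j hj, hval j' hj']
    -- Past the end of the string both entries are the default `0`.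
    · have h1 : (k + 1) * (m + a) ≤ i * (m + a) := Nat.mul_le_mul_right _ h
      rw [List.getD_eq_default _ _ (by omega), List.getD_eq_default _ _ (by omega)]

/-- The blocks of a parametric polynomial that defines an `(A, 1)`-periodic sequence are
supported in `[-A, A]`. -/
theorem IsPWP.blockBound {f : ParamPoly} {A : ℕ} (h : IsPWP A 1 fun δ : ℕ => f.inst δ) :
    BlockBound f A := by
  obtain ⟨-, s, t, hst, n, p, hn, hp, N, hN, hpres⟩ := h
  obtain ⟨C, hC⟩ := exists_blockBound f
  intro i e he
  by_contra! hA
  have heC := hC i e he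
  obtain ⟨C, rfl⟩ := Int.eq_ofNat_of_zero_le ((abs_nonneg e).trans heC)
  obtain ⟨k, rfl⟩ : ∃ k : ℕ, t = s + k := ⟨(t - s).toNat, by omega⟩
  -- Gaps longer than `2 * C` leave room for an exponent that no block reaches.
  obtain ⟨m, hm⟩ : ∃ m : ℕ, m = N + 2 * C + 2 := ⟨_, rfl⟩
  obtain ⟨δ, hδ⟩ : ∃ δ : ℕ, δ = m + (2 * A + 1) := ⟨_, rfl⟩
  have hw := hpres δ (by omega)
  rw [show δ - (2 * A + 1) = m by omega, show (s + k - s : ℤ).toNat = k by omega] at hw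
  have hlen := length_pwpString (m := m) hn hp
  have hg := getD_pwpString (m := m) hn hp
  rw [← hδ] at hlen hg
  have hstart : (δ : ℤ) * (s + k) + A - (pwpString n p s m k).length + 1 = s * δ - A := by
    rw [hlen]
    push_cast
    ring
  have hne : (f.inst δ).coeff (i * δ + e) ≠ 0 := by
    rwa [coeff_inst_near hC i e (by omega)]
  obtain ⟨x, hx⟩ := hw.exists_nat hne
  rw [hstart] at hx
  have hδ0 : (0 : ℤ) < δ := by omega
  obtain ⟨l, r, hr1, hr2, hlr⟩ : ∃ l r : ℤ, 2 * A + 1 ≤ r ∧ r < δ ∧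
      (i - s) * δ + e + A = l * δ + r := by
    -- An exponent `e > A` falls in the gap after node `i`, and `e < -A` in the gap before it.
    rcases lt_abs.1 hA with h | h
    · exact ⟨i - s, e + A, by omega, by rw [abs_le] at heC; omega, by ring⟩
    · exact ⟨i - s - 1, e + A + δ, by rw [abs_le] at heC; omega, by omega, by ring⟩
  have hxl : (x : ℤ) = l * δ + r := by linarith
  have hl : 0 ≤ l := by
    by_contra! hl
    nlinarith
  obtain ⟨l, rfl⟩ := Int.eq_ofNat_of_zero_le hl
  obtain ⟨r, rfl⟩ := Int.eq_ofNat_of_zero_le (by omega : 0 ≤ r)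
  obtain ⟨j, rfl⟩ : ∃ j, r = 2 * A + 1 + j := ⟨r - (2 * A + 1), by omega⟩
  have hx' : x = l * δ + (2 * A + 1) + j := by
    zify
    rw [hxl]
    push_cast
    ring
  -- This place in the same gap has exponent `(s + l) * δ + C + 1`, out of reach of every block. Its
  -- coefficient is therefore `0`, while constancy on the gap makes it nonzero.
  obtain ⟨j', hj'⟩ : ∃ j', A + C + 1 = 2 * A + 1 + j' := ⟨C - A, by omega⟩
  have hgap := hg l (j := j) (j' := j') (by omega) (by omega)
  rw [← hx', ← hw.coeff_add, ← hw.coeff_add, hstart, ← hx] at hgap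
  rw [hgap] at hne
  obtain ⟨i', hi'⟩ := exists_of_coeff_inst hne
  have hb := hC _ _ hi'
  have heq : (s * δ - A + (l * δ + (2 * A + 1) + j' : ℕ) - i' * δ : ℤ) =
      (s + l - i') * δ + (C + 1) := by
    push_cast
    have : (A : ℤ) + C + 1 = 2 * A + 1 + j' := by exact_mod_cast hj'
    linear_combination -this
  rw [heq, abs_le] at hb
  rcases le_or_gt 0 (s + l - i') with h | h
  · nlinarith
  · nlinarith

/-! ### Extreme blocks, and descent to a bounded witness -/

theorem ordδ_le_and_le_degδ (f : ParamPoly) (i : ℤ) (hi : f i ≠ 0) :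
    f.ordδ ≤ i ∧ i ≤ f.degδ := by
  have hm := Finsupp.mem_support_iff.2 hi
  rw [ParamPoly.ordδ, ParamPoly.degδ, dif_pos ⟨i, hm⟩, dif_pos ⟨i, hm⟩]
  exact ⟨Finset.min'_le _ _ hm, Finset.le_max' _ _ hm⟩

theorem apply_ordδ_ne_zero {f : ParamPoly} (hf : f ≠ 0) : f f.ordδ ≠ 0 := by
  have hs := Finsupp.support_nonempty_iff.2 hf
  rw [ParamPoly.ordδ, dif_pos hs]
  exact Finsupp.mem_support_iff.1 (Finset.min'_mem _ hs)

theorem apply_degδ_ne_zero {f : ParamPoly} (hf : f ≠ 0) : f f.degδ ≠ 0 := by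
  have hs := Finsupp.support_nonempty_iff.2 hf
  rw [ParamPoly.degδ, dif_pos hs]
  exact Finsupp.mem_support_iff.1 (Finset.max'_mem _ hs)

/-- A nonnegative witness can be lowered to one below `M` if every witness above `M` can be lowered
by `p ≤ M`. -/
theorem exists_le_of_descent {W : ℤ → Prop} {M p : ℤ} (hp : 0 < p) (hpM : p ≤ M)
    (h : ∀ δ, M < δ → W δ → W (δ - p)) (δ : ℤ) (h0 : 0 ≤ δ) (hδ : W δ) :
    ∃ δ, 0 ≤ δ ∧ δ ≤ M ∧ W δ := by
  induction hn : δ.toNat using Nat.strong_induction_on generalizing δ with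
  | _ n ih =>
    by_cases hM : δ ≤ M
    · exact ⟨δ, h0, hM, hδ⟩
    · exact ih (δ - p).toNat (by omega) (δ - p) (by omega) (h δ (by omega) hδ) rfl

end DivPlus

theorem mainTheorem3 (f g : DivPlus.ParamPoly) (hf : f ≠ 0) (A B : ℕ) (hAB : A ≤ B)
    (hfA : DivPlus.IsPWP A 1 fun δ : ℕ => f.inst δ)
    (hgB : DivPlus.IsPWP B 1 fun δ : ℕ => g.inst δ)
    (P : ℕ) (hP : DivPlus.IsReturnConst (DivPlus.normalize (f f.degδ)) P) :
    (DivPlus.spanDiff f g < 0 →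
      (DivPlus.DIVPlus f g ↔
        ∃ δ : ℤ, 0 ≤ δ ∧ δ ≤ 2 * B + 2 * A ∧ f.inst δ ∣ g.inst δ)) ∧
    (0 ≤ DivPlus.spanDiff f g →
      (DivPlus.DIVPlus f g ↔
        ∃ δ : ℤ, 0 ≤ δ ∧
          δ ≤ (P : ℤ) ^ (DivPlus.spanDiff f g).toNat
            + 2 * (B + 4 * A * DivPlus.spanDiff f g) + 4 * A + 1 ∧
          f.inst δ ∣ g.inst δ)) := by
  have bf := hfA.blockBound
  have bg := hgB.blockBound
  have hs := DivPlus.apply_ordδ_ne_zero hf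
  have ht := DivPlus.apply_degδ_ne_zero hf
  have hfs := DivPlus.ordδ_le_and_le_degδ f
  have hgs := DivPlus.ordδ_le_and_le_degδ g
  refine ⟨fun hΔ => ⟨?_, fun ⟨δ, h0, _, hd⟩ => ⟨δ, h0, hd⟩⟩,
    fun hΔ => ⟨?_, fun ⟨δ, h0, _, hd⟩ => ⟨δ, h0, hd⟩⟩⟩
  · rintro ⟨δ, h0, hd⟩
    by_cases hδ : δ ≤ 2 * B + 2 * A
    · exact ⟨δ, h0, hδ, hd⟩
    · have hg0 : g = 0 := DivPlus.eq_zero_of_dvd bf bg hs ht hgs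
        (by rw [DivPlus.spanDiff] at hΔ; omega) (by omega) hd
      exact ⟨0, le_rfl, by omega, by rw [hg0, DivPlus.inst_zero]; exact dvd_zero _⟩
  · rintro ⟨δ, h0, hd⟩
    obtain ⟨d, hdΔ⟩ := Int.eq_ofNat_of_zero_le hΔ
    rw [hdΔ]
    rw [DivPlus.spanDiff] at hdΔ
    rw [Int.toNat_natCast]
    have hAd : (0 : ℤ) ≤ A * d := by positivity
    have hP0 : (0 : ℤ) < (P : ℤ) ^ d := pow_pos (by exact_mod_cast hP.1) d
    -- Descent works above `2 * B + 2 * (d + 2) * A`, which the stated bound exceeds; its summand `P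
    -- ^ d` keeps lowered witnesses nonnegative.
    refine DivPlus.exists_le_of_descent (W := fun δ => f.inst δ ∣ g.inst δ) hP0
      (by nlinarith) (fun δ hδ hd => ?_) δ h0 hd
    have := DivPlus.dvd_inst_sub_of_dvd (d := d) bf bg hfs hs ht
      (fun i hi => ⟨(hgs i hi).1, (hgs i hi).2.trans (by omega)⟩) hP (by nlinarith) hd
      (by positivity)
    exact_mod_cast this
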